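/- Let $T=\mathbb Z$ or $T=\mathbb R$, and let $T^*=[-\pi,\pi]$ if $T=\mathbb Z$ and $T^*=\mathbb R$ if $T=\mathbb R$. For all $a,m,M>0$ there exists a constant $C=C(a,m,M)>0$ with the following property. Let $f:T\to\mathbb R$ be a Gaussian stationary process (all finite marginals $(f(t_1),\dots,f(t_n))$ are multivariate Gaussian and their laws are invariant under shifts by elements of $T$; in case $T=\mathbb R$ the paths of $f$ are, moreover, almost surely continuous). Let $\rho$ be its spectral measure, that is, a finite non-negative measure on $T^*$ such that $$\mathbb E[f(0)f(t)]=\int_{T^*}e^{-i\lambda t}\,d\rho(\lambda)\qquad\text{for all }t\in T,$$ and suppose that $\int_{T^*}|\lambda|^\delta\,d\rho(\lambda)<\infty$ for some $\delta>0$, and that $$m|I|\le\rho(I)\le M|I|\qquad\text{for every interval } I\subset(-a,a)\cap T^*,$$ where $|I|$ is the length of $I$. Then there is $N_0$ (which may depend on $f$) such that for all real $N\ge N_0$, $$H_f(N):=\mathbb P\bigl(f(t)>0\text{ for all }t\in[0,N)\cap T\bigr)\le e^{-CN}.$$ -/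

import Mathlib

open MeasureTheory ProbabilityTheory Filter

noncomputable section

namespace GaussianPersistence

/-- A time set `T` with its inclusion into `ℝ`, and with its dual `T*` as a subset of `ℝ`.
It is used only for the two instances below. -/
class TimeSet (T : Type) where
  toReal : T → ℝ
  dual : Set ℝ

/-- `T = ℤ`, with dual `[-π, π]`. -/
instance : TimeSet ℤ where
  toReal n := (n : ℝ)
  dual := Set.Icc (-Real.pi) Real.pi

/-- `T = ℝ`, with dual `ℝ`. -/
instance : TimeSet ℝ where
  toReal t := t
  dual := Set.univ

variable {Ω : Type*} [MeasurableSpace Ω] {T : Type}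

/-- A Gaussian stationary process on `T`: all finite marginals are (possibly degenerate) Gaussian
vectors, the finite marginals are invariant under all shifts by elements of `T`, and almost every
path is continuous (no restriction for the discrete space `ℤ`). -/
structure IsGaussianStationary [AddCommGroup T] [TopologicalSpace T]
    (f : T → Ω → ℝ) (P : Measure Ω) : Prop where
  gaussian : IsGaussianProcess f P
  stationary : ∀ (s : T) (n : ℕ) (t : Fin n → T),
    IdentDistrib (fun ω i => f (t i + s) ω) (fun ω i => f (t i) ω) P P
  continuous_paths : ∀ᵐ ω ∂P, Continuous fun t => f t ω

/-- The covariance function `r(t) = E[f(0) f(t)]`. -/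
def covarianceFn [Zero T] (f : T → Ω → ℝ) (P : Measure Ω) (t : T) : ℝ :=
  ∫ ω, f 0 ω * f t ω ∂P

/-- `ρ` is a spectral measure of `f`: a finite measure on `T*` (regarded as a measure on `ℝ`
carried by `T*`) with `r(t) = ∫ exp(-iλt) dρ(λ)` for all `t ∈ T`. -/
structure IsSpectralMeasure [Zero T] [TimeSet T]
    (f : T → Ω → ℝ) (P : Measure Ω) (ρ : Measure ℝ) : Prop where
  finite : IsFiniteMeasure ρ
  carried : ρ (TimeSet.dual T)ᶜ = 0
  fourier : ∀ t : T, (covarianceFn f P t : ℂ) =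
    ∫ l : ℝ, Complex.exp (-(Complex.I * (l : ℂ) * (TimeSet.toReal t : ℂ))) ∂ρ

/-- The moment condition: `∫ |λ|^δ dρ(λ) < ∞` for some `δ > 0`. -/
def MomentCondition (ρ : Measure ℝ) : Prop :=
  ∃ δ : ℝ, 0 < δ ∧ ∫⁻ l : ℝ, ENNReal.ofReal (|l| ^ δ) ∂ρ < ⊤

/-- `m |I| ≤ ρ(I) ≤ M |I|` for every interval `I ⊆ (-a, a)` of the dual of `T`. -/
def ComparableNearZero (T : Type) [TimeSet T] (ρ : Measure ℝ) (a m M : ℝ) : Prop :=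
  ∀ I : Set ℝ, I.OrdConnected → I ⊆ Set.Ioo (-a) a ∩ TimeSet.dual T →
    ENNReal.ofReal m * volume I ≤ ρ I ∧ ρ I ≤ ENNReal.ofReal M * volume I

/-- The gap (persistence) probability `H_f(N) = P(f(t) > 0 for all t ∈ [0, N) ∩ T)`. -/
def gapProbability [TimeSet T] (f : T → Ω → ℝ) (P : Measure Ω) (N : ℝ) : ℝ :=
  P.real {ω | ∀ t : T, TimeSet.toReal t ∈ Set.Ico 0 N → 0 < f t ω}

end GaussianPersistence

end

/-!
Let `d` be so large that `π / d ≤ a`. Along a progression of step `d`, the linear combinations of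
`f` have variance `∫ |∑ a j exp (i l j d)|² dρ(l)`, which is at least `(2 π m / d) ∑ (a j)²` by
orthogonality of the exponentials on `(-π / d, π / d)`. Hence the Gaussian vector of the `n` values
of `f` on the progression is an independent Gaussian vector plus an independent remainder, and
`E ∏ F (f (t j)) ≤ (C ∫ F) ^ n` for all `F ≥ 0`. Taking `F x = 1_{x > 0} exp (-x / K)` with `K`
small, and averaging over the shifts of the progression within a fine grid (Jensen), Markov's
inequality bounds the probability that `f > 0` on the grid in `[0, n d)` with mean at most `K` there
by `exp (-n)`. On the other hand the variance of this mean is the integral of a Fejér kernel against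
`ρ`, which is `O (1 / n)` because the density of `ρ` near `0` is bounded, so this mean exceeds `K`
with probability at most `exp (-c n)`; the same estimate forces the expectation of `f` to vanish.
The grid is refined, depending on `n`, until the part of `ρ` beyond its Nyquist frequency, where the
Fejér kernel need not be small, is negligible.
-/

namespace GaussianPersistence

open Set
open scoped Real ENNReal NNReal

section GaussianVectors

variable {ι : Type*} [Fintype ι]

lemma exists_isGaussian_covarianceBilin_eq (m : EuclideanSpace ℝ ι)
    {B : LinearMap.BilinForm ℝ (EuclideanSpace ℝ ι)} (hsymm : ∀ x y, B x y = B y x)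
    (hnonneg : ∀ x, 0 ≤ B x x) :
    ∃ ν : Measure (EuclideanSpace ℝ ι), IsGaussian ν ∧ ν[id] = m ∧
      ∀ x y, covarianceBilin ν x y = B x y := by
  classical
  let e := (EuclideanSpace.basisFun ι ℝ).toBasis
  have hB : ∀ x y : EuclideanSpace ℝ ι,
      B x y = x.ofLp ⬝ᵥ (LinearMap.BilinForm.toMatrix e B).mulVec y.ofLp := fun x y ↦ by
    rw [LinearMap.BilinForm.apply_eq_dotProduct_toMatrix_mulVec e]
    rfl
  have hS : (LinearMap.BilinForm.toMatrix e B).PosSemidef := by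
    refine .of_dotProduct_mulVec_nonneg (Matrix.IsHermitian.ext fun i j ↦ ?_) fun x ↦ ?_
    · simp only [LinearMap.BilinForm.toMatrix_apply, star_trivial, hsymm (e j)]
    · rw [star_trivial, ← hB (WithLp.toLp 2 x) (WithLp.toLp 2 x)]
      exact hnonneg _
  exact ⟨multivariateGaussian m (LinearMap.BilinForm.toMatrix e B), inferInstance,
    integral_id_multivariateGaussian',
    fun x y ↦ (covarianceBilin_multivariateGaussian hS x y).trans (hB x y).symm⟩

lemma exists_eq_conv_of_covarianceBilin_le {γ μ : Measure (EuclideanSpace ℝ ι)} [IsGaussian γ]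
    [IsGaussian μ] (h : ∀ x, covarianceBilin γ x x ≤ covarianceBilin μ x x) :
    ∃ ν : Measure (EuclideanSpace ℝ ι), IsGaussian ν ∧ μ = γ ∗ ν := by
  obtain ⟨ν, hν, hmean, hcov⟩ := exists_isGaussian_covarianceBilin_eq (μ[id] - γ[id])
    (B := (covarianceBilin μ - covarianceBilin γ).toBilinForm)
    (fun x y ↦ by simp [covarianceBilin_comm x]) fun x ↦ sub_nonneg.2 (h x)
  refine ⟨ν, hν, Measure.ext_of_charFun (funext fun t ↦ ?_)⟩
  have hcov' : covarianceBilin ν t t = covarianceBilin μ t t - covarianceBilin γ t t := hcov t t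
  rw [charFun_conv, IsGaussian.charFun_eq', IsGaussian.charFun_eq', IsGaussian.charFun_eq', hmean,
    hcov', inner_sub_right, ← Complex.exp_add]
  congr 1
  push_cast
  ring

lemma isGaussian_map_toLp_pi_gaussianReal (c : ℝ≥0) :
    IsGaussian ((Measure.pi fun _ : ι ↦ gaussianReal 0 c).map (WithLp.toLp 2)) := by
  have hlaw : ∀ i, HasGaussianLaw (fun y : ι → ℝ ↦ y i) (Measure.pi fun _ : ι ↦ gaussianReal 0 c) :=
    fun i ↦ ⟨by
      rw [(measurePreserving_eval (fun _ : ι ↦ gaussianReal 0 c) i).map_eq]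
      infer_instance⟩
  have hindep := iIndepFun_pi (μ := fun _ : ι ↦ gaussianReal 0 c) (X := fun _ x ↦ x)
    fun _ ↦ aemeasurable_id
  exact ((hindep.hasGaussianLaw hlaw).toLp_pi 2).isGaussian_map

lemma covarianceBilin_map_toLp_pi_gaussianReal_self (c : ℝ≥0) (x : EuclideanSpace ℝ ι) :
    covarianceBilin ((Measure.pi fun _ : ι ↦ gaussianReal 0 c).map (WithLp.toLp 2)) x x =
      c * ‖x‖ ^ 2 := by
  have := isGaussian_map_toLp_pi_gaussianReal (ι := ι) c
  have hinner : (fun y : EuclideanSpace ℝ ι ↦ inner ℝ x y) ∘ WithLp.toLp 2 =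
      ∑ i, fun y : ι → ℝ ↦ x i * y i := by
    ext y
    simp [PiLp.inner_apply, mul_comm]
  rw [covarianceBilin_self IsGaussian.memLp_two_id, variance_map (by fun_prop) (by fun_prop),
    hinner, variance_sum_pi (X := fun i y ↦ x i * y)
      fun _ ↦ (memLp_id_gaussianReal 2).const_mul _, EuclideanSpace.real_norm_sq_eq, Finset.mul_sum]
  refine Finset.sum_congr rfl fun i _ ↦ ?_
  rw [variance_const_mul, variance_fun_id_gaussianReal, mul_comm]

lemma lintegral_gaussianReal_le (μ : ℝ) {v : ℝ≥0} (hv : v ≠ 0) (F : ℝ → ℝ≥0∞) :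
    ∫⁻ x, F x ∂(gaussianReal μ v) ≤ ENNReal.ofReal (√(2 * π * v))⁻¹ * ∫⁻ x, F x := by
  rw [gaussianReal_of_var_ne_zero μ hv,
    lintegral_withDensity_eq_lintegral_mul_non_measurable _ (measurable_gaussianPDF μ v)
      (.of_forall fun _ ↦ ENNReal.ofReal_lt_top),
    ← lintegral_const_mul' _ _ ENNReal.ofReal_ne_top]
  refine lintegral_mono fun x ↦ ?_
  have hexp : Real.exp (-(x - μ) ^ 2 / (2 * v)) ≤ 1 :=
    Real.exp_le_one_iff.2 (div_nonpos_of_nonpos_of_nonneg (neg_nonpos.2 (sq_nonneg _))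
      (by positivity))
  simp only [Pi.mul_apply, gaussianPDF, gaussianPDFReal]
  gcongr
  exact mul_le_of_le_one_right (by positivity) hexp

lemma lintegral_pi_prod_gaussianReal_le {v : ℝ≥0} (hv : v ≠ 0) {F : ℝ → ℝ≥0∞}
    (hF : Measurable F) (y : ι → ℝ) :
    ∫⁻ x, ∏ i, F (x i + y i) ∂(Measure.pi fun _ : ι ↦ gaussianReal 0 v) ≤
      (ENNReal.ofReal (√(2 * π * v))⁻¹ * ∫⁻ x, F x) ^ Fintype.card ι := by
  have hFy : ∀ i, Measurable fun x ↦ F (x + y i) := fun i ↦ by fun_prop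
  have hindep := iIndepFun_pi (μ := fun _ : ι ↦ gaussianReal 0 v) (X := fun i x ↦ F (x + y i))
    fun i ↦ (hFy i).aemeasurable
  rw [lintegral_prod_eq_prod_lintegral_of_indepFun Finset.univ _ hindep fun i ↦ by fun_prop,
    Fintype.card, ← Finset.prod_const]
  refine Finset.prod_le_prod' fun i _ ↦ ?_
  calc ∫⁻ x, F (x i + y i) ∂(Measure.pi fun _ : ι ↦ gaussianReal 0 v)
      = ∫⁻ x, F (x + y i) ∂(gaussianReal 0 v) :=
        (measurePreserving_eval (fun _ : ι ↦ gaussianReal 0 v) i).lintegral_comp (hFy i)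
    _ ≤ ENNReal.ofReal (√(2 * π * v))⁻¹ * ∫⁻ x, F (x + y i) := lintegral_gaussianReal_le 0 hv _
    _ = ENNReal.ofReal (√(2 * π * v))⁻¹ * ∫⁻ x, F x := by rw [lintegral_add_right_eq_self F]

variable {Ω : Type*} [MeasurableSpace Ω] {P : Measure Ω}

lemma lintegral_prod_le_of_variance_ge {Y : ι → Ω → ℝ} (hY : HasGaussianLaw (fun ω ↦ (Y · ω)) P)
    {c : ℝ≥0} (hc : c ≠ 0)
    (hvar : ∀ a : ι → ℝ, c * ∑ i, a i ^ 2 ≤ Var[fun ω ↦ ∑ i, a i * Y i ω; P])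
    {F : ℝ → ℝ≥0∞} (hF : Measurable F) :
    ∫⁻ ω, ∏ i, F (Y i ω) ∂P ≤
      (ENNReal.ofReal (√(2 * π * c))⁻¹ * ∫⁻ x, F x) ^ Fintype.card ι := by
  have hY2 := hY.toLp_pi 2
  have hμ := hY2.isGaussian_map
  have hγ := isGaussian_map_toLp_pi_gaussianReal (ι := ι) c
  obtain ⟨ν, hν, hconv⟩ := exists_eq_conv_of_covarianceBilin_le
      (γ := (Measure.pi fun _ : ι ↦ gaussianReal 0 c).map (WithLp.toLp 2))
      (μ := P.map fun ω ↦ WithLp.toLp 2 (Y · ω)) fun x ↦ by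
    rw [covarianceBilin_map_toLp_pi_gaussianReal_self, covarianceBilin_self IsGaussian.memLp_two_id,
      variance_map (by fun_prop) hY2.aemeasurable, EuclideanSpace.real_norm_sq_eq]
    convert hvar x using 2
    ext ω
    simp [PiLp.inner_apply, mul_comm]
  have hFprod : Measurable fun x : EuclideanSpace ℝ ι ↦ ∏ i, F (x i) := by fun_prop
  calc ∫⁻ ω, ∏ i, F (Y i ω) ∂P
      = ∫⁻ x, ∏ i, F (x i) ∂(P.map fun ω ↦ WithLp.toLp 2 (Y · ω)) :=
        (lintegral_map' hFprod.aemeasurable hY2.aemeasurable).symm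
    _ = ∫⁻ y, ∫⁻ x, ∏ i, F (x i + y i) ∂(Measure.pi fun _ : ι ↦ gaussianReal 0 c) ∂ν := by
        rw [hconv, Measure.conv_comm, Measure.lintegral_conv hFprod]
        refine lintegral_congr fun y ↦ ?_
        rw [lintegral_map (by fun_prop) (by fun_prop)]
        simp only [PiLp.add_apply, add_comm]
    _ ≤ ∫⁻ _, (ENNReal.ofReal (√(2 * π * c))⁻¹ * ∫⁻ x, F x) ^ Fintype.card ι ∂ν :=
        lintegral_mono fun y ↦ lintegral_pi_prod_gaussianReal_le hc hF y.ofLp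
    _ = _ := by rw [lintegral_const, measure_univ, mul_one]

lemma hasSubgaussianMGF_of_hasGaussianLaw {Y : Ω → ℝ} (hY : HasGaussianLaw Y P) (hmean : P[Y] = 0)
    {v : ℝ≥0} (hv : Var[Y; P] ≤ v) : HasSubgaussianMGF Y v P where
  integrable_exp_mul t := by
    have := integrable_exp_mul_gaussianReal (μ := P[Y]) (v := Var[Y; P].toNNReal) t
    rw [← hY.map_eq_gaussianReal] at this
    exact this.comp_aemeasurable hY.aemeasurable
  mgf_le t := by
    rw [mgf_gaussianReal hY.map_eq_gaussianReal, hmean, zero_mul, zero_add]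
    gcongr
    exact Real.toNNReal_le_iff_le_coe.2 hv

lemma hasGaussianLaw_of_isGaussianProcess {S κ : Type*} [Finite κ] {X : S → Ω → ℝ}
    (hX : IsGaussianProcess X P) (u : κ → S) : HasGaussianLaw (fun ω k ↦ X (u k) ω) P := by
  have := Fintype.ofFinite κ
  let L : (↥(Finset.univ : Finset κ) → ℝ) →L[ℝ] κ → ℝ :=
    ContinuousLinearMap.pi fun k ↦ ContinuousLinearMap.proj ⟨k, Finset.mem_univ k⟩
  exact ((hX.comp_right u).hasGaussianLaw Finset.univ).map L

end GaussianVectors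

lemma restrict_le_restrict_of_forall_closedBall_le {α : Type*} [MetricSpace α]
    [SecondCountableTopology α] [HasBesicovitchCovering α] [MeasurableSpace α] [BorelSpace α]
    {μ ν : Measure α} [SFinite μ] [IsLocallyFiniteMeasure ν] {U : Set α} (hU : IsOpen U)
    (h : ∀ x r, Metric.closedBall x r ⊆ U → μ (Metric.closedBall x r) ≤ ν (Metric.closedBall x r)) :
    μ.restrict U ≤ ν.restrict U := by
  refine Measure.le_iff.2 fun s hs ↦ ?_
  rw [Measure.restrict_apply hs, Measure.restrict_apply hs]
  refine (Besicovitch.vitaliFamily μ).measure_le_of_frequently_le ν .rfl _ fun x hx ↦ ?_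
  refine (Besicovitch.tendsto_filterAt μ x).frequently (Eventually.frequently ?_)
  obtain ⟨ε, hε, hball⟩ := Metric.isOpen_iff.1 hU x hx.2
  filter_upwards [Ioo_mem_nhdsGT hε] with r hr
  exact h x r ((Metric.closedBall_subset_ball hr.2).trans hball)

lemma ComparableNearZero.restrict_le {T : Type} [TimeSet T] {ρ : Measure ℝ} [IsFiniteMeasure ρ]
    {a m M b : ℝ} (h : ComparableNearZero T ρ a m M)
    (hb : Ioo (-b) b ⊆ Ioo (-a) a ∩ TimeSet.dual T) :
    (ENNReal.ofReal m • volume).restrict (Ioo (-b) b) ≤ ρ.restrict (Ioo (-b) b) ∧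
      ρ.restrict (Ioo (-b) b) ≤ (ENNReal.ofReal M • volume).restrict (Ioo (-b) b) := by
  have hball : ∀ x r, Metric.closedBall x r ⊆ Ioo (-b) b →
      ENNReal.ofReal m * volume (Metric.closedBall x r) ≤ ρ (Metric.closedBall x r) ∧
        ρ (Metric.closedBall x r) ≤ ENNReal.ofReal M * volume (Metric.closedBall x r) :=
    fun x r hr ↦ h _ (by rw [Real.closedBall_eq_Icc]; exact ordConnected_Icc) (hr.trans hb)
  have : IsLocallyFiniteMeasure (ENNReal.ofReal M • (volume : Measure ℝ)) :=
    inferInstanceAs (IsLocallyFiniteMeasure (M.toNNReal • (volume : Measure ℝ)))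
  exact ⟨restrict_le_restrict_of_forall_closedBall_le isOpen_Ioo fun x r hr ↦ (hball x r hr).1,
    restrict_le_restrict_of_forall_closedBall_le isOpen_Ioo fun x r hr ↦ (hball x r hr).2⟩

lemma setIntegral_le_mul_integral {α : Type*} [MeasurableSpace α] {μ ν : Measure α} {U : Set α}
    {M : ℝ} (hM : 0 ≤ M) (hμ : μ.restrict U ≤ (ENNReal.ofReal M • ν).restrict U)
    {g : α → ℝ} (hg : Integrable g ν) (hg0 : ∀ x, 0 ≤ g x) :
    IntegrableOn g U μ ∧ ∫ x in U, g x ∂μ ≤ M * ∫ x, g x ∂ν := by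
  have hgM : Integrable g (ENNReal.ofReal M • ν) := hg.smul_measure ENNReal.ofReal_ne_top
  refine ⟨hgM.restrict.mono_measure hμ, ?_⟩
  calc ∫ x in U, g x ∂μ ≤ ∫ x in U, g x ∂(ENNReal.ofReal M • ν) :=
        integral_mono_measure hμ (.of_forall hg0) hgM.restrict
    _ ≤ ∫ x, g x ∂(ENNReal.ofReal M • ν) := setIntegral_le_integral hgM (.of_forall hg0)
    _ = M * ∫ x, g x ∂ν := by
        rw [integral_smul_measure, ENNReal.toReal_ofReal hM, smul_eq_mul]

section TrigEnergy

variable {ι : Type*} [Fintype ι]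

/-- The squared modulus of the trigonometric polynomial `∑ j, a j * exp (i l τ j)`: the image of a
linear combination of a stationary process under the spectral isometry. -/
noncomputable def trigEnergy (a τ : ι → ℝ) (l : ℝ) : ℝ :=
  ‖∑ j, (a j : ℂ) * Complex.exp (↑(l * τ j) * Complex.I)‖ ^ 2

lemma trigEnergy_nonneg (a τ : ι → ℝ) (l : ℝ) : 0 ≤ trigEnergy a τ l := sq_nonneg _

lemma trigEnergy_comp_equiv {κ : Type*} [Fintype κ] (e : κ ≃ ι) (a τ : ι → ℝ) (l : ℝ) :
    trigEnergy (fun k ↦ a (e k)) (fun k ↦ τ (e k)) l = trigEnergy a τ l := by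
  rw [trigEnergy, trigEnergy,
    Equiv.sum_comp e fun j ↦ (a j : ℂ) * Complex.exp (↑(l * τ j) * Complex.I)]

lemma trigEnergy_eq_sum_cos (a τ : ι → ℝ) (l : ℝ) :
    trigEnergy a τ l = ∑ i, ∑ j, a i * a j * Real.cos (l * (τ i - τ j)) := by
  have hre : (∑ j, (a j : ℂ) * Complex.exp (↑(l * τ j) * Complex.I)).re =
      ∑ j, a j * Real.cos (l * τ j) := by
    simp only [Complex.re_sum, Complex.re_ofReal_mul, Complex.exp_ofReal_mul_I_re]
  have him : (∑ j, (a j : ℂ) * Complex.exp (↑(l * τ j) * Complex.I)).im =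
      ∑ j, a j * Real.sin (l * τ j) := by
    simp only [Complex.im_sum, Complex.im_ofReal_mul, Complex.exp_ofReal_mul_I_im]
  rw [trigEnergy, ← Complex.normSq_eq_norm_sq, Complex.normSq_apply, hre, him]
  simp only [Finset.sum_mul_sum, ← Finset.sum_add_distrib, mul_sub, Real.cos_sub]
  refine Finset.sum_congr rfl fun i _ ↦ Finset.sum_congr rfl fun j _ ↦ ?_
  ring

lemma integrable_cos_mul (ρ : Measure ℝ) [IsFiniteMeasure ρ] (s : ℝ) :
    Integrable (fun l ↦ Real.cos (l * s)) ρ :=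
  Integrable.of_bound (by fun_prop : Continuous _).aestronglyMeasurable 1
    (.of_forall fun l ↦ by simpa using Real.abs_cos_le_one _)

lemma integrable_trigEnergy (ρ : Measure ℝ) [IsFiniteMeasure ρ] (a τ : ι → ℝ) :
    Integrable (trigEnergy a τ) ρ := by
  rw [funext (trigEnergy_eq_sum_cos a τ)]
  exact integrable_finsetSum _ fun i _ ↦ integrable_finsetSum _ fun j _ ↦
    (integrable_cos_mul ρ _).const_mul _

lemma integral_trigEnergy (ρ : Measure ℝ) [IsFiniteMeasure ρ] (a τ : ι → ℝ) :
    ∫ l, trigEnergy a τ l ∂ρ =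
      ∑ i, ∑ j, a i * a j * ∫ l, Real.cos (l * (τ i - τ j)) ∂ρ := by
  have hint : ∀ i j, Integrable (fun l ↦ a i * a j * Real.cos (l * (τ i - τ j))) ρ := fun i j ↦
    (integrable_cos_mul ρ _).const_mul _
  simp_rw [trigEnergy_eq_sum_cos]
  rw [integral_finsetSum _ fun i _ ↦ integrable_finsetSum _ fun j _ ↦ hint i j]
  refine Finset.sum_congr rfl fun i _ ↦ ?_
  rw [integral_finsetSum _ fun j _ ↦ hint i j]
  simp_rw [integral_const_mul]

lemma integral_cos_int_mul {d : ℝ} (hd : 0 < d) (k : ℤ) :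
    ∫ l in Ioo (-(π / d)) (π / d), Real.cos (l * (k * d)) =
      if k = 0 then 2 * (π / d) else 0 := by
  have hπd : 0 < π / d := div_pos Real.pi_pos hd
  rw [← integral_Ioc_eq_integral_Ioo, ← intervalIntegral.integral_of_le (by linarith)]
  split_ifs with hk
  · simp only [hk, Int.cast_zero, zero_mul, mul_zero, Real.cos_zero,
      intervalIntegral.integral_const, smul_eq_mul, mul_one]
    ring
  · have hkd : (k : ℝ) * d ≠ 0 := mul_ne_zero (Int.cast_ne_zero.2 hk) hd.ne'
    have hend : π / d * (k * d) = k * π := by field_simp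
    rw [intervalIntegral.integral_comp_mul_right _ hkd, integral_cos, neg_mul, hend, Real.sin_neg,
      Real.sin_int_mul_pi, neg_zero, sub_zero, smul_zero]

lemma integral_trigEnergy_progression {n : ℕ} (a : Fin n → ℝ) (s : ℝ) {d : ℝ} (hd : 0 < d) :
    ∫ l in Ioo (-(π / d)) (π / d), trigEnergy a (fun j ↦ s + j * d) l =
      2 * (π / d) * ∑ j, a j ^ 2 := by
  have hdiff : ∀ i j : Fin n, s + i * d - (s + j * d) = ((i - j : ℤ) : ℝ) * d := fun i j ↦ by
    push_cast
    ring
  have hzero : ∀ i j : Fin n, (i - j : ℤ) = 0 ↔ i = j := fun i j ↦ by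
    rw [sub_eq_zero, Nat.cast_inj, Fin.val_inj]
  rw [integral_trigEnergy]
  simp only [hdiff, integral_cos_int_mul hd, hzero, mul_ite, mul_zero, Finset.sum_ite_eq,
    Finset.mem_univ, if_true, Finset.mul_sum]
  exact Finset.sum_congr rfl fun i _ ↦ by ring

end TrigEnergy

/-- The real family `X` is square integrable and has the second moments of a stationary process
with spectral measure `ρ` observed at the times `τ`; the values being real, only the cosine part of
the Fourier transform of `ρ` appears. -/
structure HasSpectralCovariance {Ω ι : Type*} [MeasurableSpace Ω] (X : ι → Ω → ℝ) (τ : ι → ℝ)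
    (P : Measure Ω) (ρ : Measure ℝ) : Prop where
  memLp : ∀ i, MemLp (X i) 2 P
  integral_mul : ∀ i j, ∫ ω, X i ω * X j ω ∂P = ∫ l, Real.cos (l * (τ i - τ j)) ∂ρ

namespace HasSpectralCovariance

variable {Ω ι κ : Type*} [MeasurableSpace Ω] {P : Measure Ω} {ρ : Measure ℝ} {X : ι → Ω → ℝ}
  {τ : ι → ℝ}

lemma comp (h : HasSpectralCovariance X τ P ρ) (u : κ → ι) :
    HasSpectralCovariance (fun k ↦ X (u k)) (fun k ↦ τ (u k)) P ρ :=
  ⟨fun k ↦ h.memLp (u k), fun k k' ↦ h.integral_mul (u k) (u k')⟩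

variable [Fintype ι]

lemma memLp_sum (h : HasSpectralCovariance X τ P ρ) (a : ι → ℝ) :
    MemLp (fun ω ↦ ∑ i, a i * X i ω) 2 P :=
  memLp_finsetSum _ fun i _ ↦ (h.memLp i).const_mul (a i)

variable [IsFiniteMeasure ρ]

lemma integral_sq_sum (h : HasSpectralCovariance X τ P ρ) (a : ι → ℝ) :
    ∫ ω, (∑ i, a i * X i ω) ^ 2 ∂P = ∫ l, trigEnergy a τ l ∂ρ := by
  have hint : ∀ i j, Integrable (fun ω ↦ a i * a j * (X i ω * X j ω)) P := fun i j ↦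
    ((h.memLp i).integrable_mul (h.memLp j)).const_mul _
  have hsq : ∀ ω, (∑ i, a i * X i ω) ^ 2 = ∑ i, ∑ j, a i * a j * (X i ω * X j ω) := fun ω ↦ by
    rw [sq, Finset.sum_mul_sum]
    exact Finset.sum_congr rfl fun i _ ↦ Finset.sum_congr rfl fun j _ ↦ by ring
  simp_rw [hsq, integral_trigEnergy, ← h.integral_mul]
  rw [integral_finsetSum _ fun i _ ↦ integrable_finsetSum _ fun j _ ↦ hint i j]
  refine Finset.sum_congr rfl fun i _ ↦ ?_
  rw [integral_finsetSum _ fun j _ ↦ hint i j]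
  simp_rw [integral_const_mul]

variable [IsProbabilityMeasure P]

lemma variance_sum_eq {μ : ℝ} (h : HasSpectralCovariance X τ P ρ) (hmean : ∀ i, P[X i] = μ)
    (a : ι → ℝ) :
    Var[fun ω ↦ ∑ i, a i * X i ω; P] = ∫ l, trigEnergy a τ l ∂ρ - ((∑ i, a i) * μ) ^ 2 := by
  have hsum : ∫ ω, ∑ i, a i * X i ω ∂P = (∑ i, a i) * μ := by
    rw [integral_finsetSum _ fun i _ ↦ ((h.memLp i).integrable one_le_two).const_mul _,
      Finset.sum_mul]
    simp_rw [integral_const_mul, hmean]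
  rw [variance_eq_sub (h.memLp_sum a), hsum, ← h.integral_sq_sum]
  rfl

lemma sq_mean_le {μ : ℝ} (h : HasSpectralCovariance X τ P ρ) (hmean : ∀ i, P[X i] = μ)
    {a : ι → ℝ} (ha : ∑ i, a i = 1) : μ ^ 2 ≤ ∫ l, trigEnergy a τ l ∂ρ := by
  have hvar := h.variance_sum_eq hmean a
  rw [ha, one_mul] at hvar
  linarith [variance_nonneg (fun ω ↦ ∑ i, a i * X i ω) P]

lemma variance_sum_eq_of_centred (h : HasSpectralCovariance X τ P ρ) (hmean : ∀ i, P[X i] = 0)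
    (a : ι → ℝ) : Var[fun ω ↦ ∑ i, a i * X i ω; P] = ∫ l, trigEnergy a τ l ∂ρ := by
  rw [h.variance_sum_eq hmean, mul_zero, zero_pow two_ne_zero, sub_zero]

lemma le_variance_sum_progression {n : ℕ} {X : Fin n → Ω → ℝ} {s d : ℝ}
    (h : HasSpectralCovariance X (fun j ↦ s + j * d) P ρ) (hmean : ∀ j, P[X j] = 0) (hd : 0 < d)
    {m : ℝ} (hm : 0 ≤ m) (hlow : (ENNReal.ofReal m • volume).restrict (Ioo (-(π / d)) (π / d)) ≤
      ρ.restrict (Ioo (-(π / d)) (π / d))) (a : Fin n → ℝ) :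
    2 * (π / d) * m * ∑ j, a j ^ 2 ≤ Var[fun ω ↦ ∑ j, a j * X j ω; P] := by
  have hint := integrable_trigEnergy ρ a fun j ↦ s + j * d
  calc 2 * (π / d) * m * ∑ j, a j ^ 2
      = ∫ l in Ioo (-(π / d)) (π / d), trigEnergy a (fun j ↦ s + j * d) l
          ∂(ENNReal.ofReal m • volume) := by
        rw [Measure.restrict_smul, integral_smul_measure, integral_trigEnergy_progression a s hd,
          ENNReal.toReal_ofReal hm, smul_eq_mul]
        ring
    _ ≤ ∫ l in Ioo (-(π / d)) (π / d), trigEnergy a (fun j ↦ s + j * d) l ∂ρ :=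
        integral_mono_measure hlow (.of_forall (trigEnergy_nonneg _ _)) hint.integrableOn
    _ ≤ ∫ l, trigEnergy a (fun j ↦ s + j * d) l ∂ρ :=
        setIntegral_le_integral hint (.of_forall (trigEnergy_nonneg _ _))
    _ = Var[fun ω ↦ ∑ j, a j * X j ω; P] := (h.variance_sum_eq_of_centred hmean a).symm

end HasSpectralCovariance

section FejerKernel

/-- The Fejér kernel, normalised to take the value `1` at `0`: the `trigEnergy` of the average over
`k` consecutive points of a grid, as a function of frequency times grid step. -/
noncomputable def fejerKernel (k : ℕ) (θ : ℝ) : ℝ :=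
  ‖(k : ℂ)⁻¹ * ∑ j ∈ Finset.range k, Complex.exp (θ * Complex.I) ^ j‖ ^ 2

lemma trigEnergy_average (k : ℕ) (h l : ℝ) :
    trigEnergy (fun _ : Fin k ↦ (k : ℝ)⁻¹) (fun j ↦ j * h) l = fejerKernel k (l * h) := by
  rw [trigEnergy, fejerKernel, ← Finset.mul_sum, Finset.sum_range, Complex.ofReal_inv,
    Complex.ofReal_natCast]
  congr 3
  refine Finset.sum_congr rfl fun j _ ↦ ?_
  rw [← Complex.exp_nat_mul]
  congr 1
  push_cast
  ring

lemma fejerKernel_le_one (k : ℕ) (θ : ℝ) : fejerKernel k θ ≤ 1 := by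
  refine pow_le_one₀ (norm_nonneg _) ?_
  rw [norm_mul, norm_inv, Complex.norm_natCast]
  refine inv_mul_le_one_of_le₀ ?_ k.cast_nonneg
  calc ‖∑ j ∈ Finset.range k, Complex.exp (θ * Complex.I) ^ j‖
      ≤ ∑ j ∈ Finset.range k, ‖Complex.exp (θ * Complex.I) ^ j‖ := norm_sum_le _ _
    _ = k := by simp [Complex.norm_exp_ofReal_mul_I]

lemma norm_geom_sum_exp_mul_abs_le (k : ℕ) {θ : ℝ} (hθ : |θ| ≤ π) :
    ‖∑ j ∈ Finset.range k, Complex.exp (θ * Complex.I) ^ j‖ * |θ| ≤ π := by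
  set z := Complex.exp (θ * Complex.I) with hz
  have hgeom : ‖∑ j ∈ Finset.range k, z ^ j‖ * ‖z - 1‖ ≤ 2 := by
    rw [← norm_mul, geom_sum_mul]
    refine (norm_sub_le _ _).trans ?_
    rw [norm_pow, hz, Complex.norm_exp_ofReal_mul_I]
    norm_num
  have hchord : 2 / π * |θ| ≤ ‖z - 1‖ := by
    have hsin := Real.mul_abs_le_abs_sin (x := θ / 2) (by rw [abs_div, abs_two]; gcongr)
    rw [hz, mul_comm (θ : ℂ), Complex.norm_exp_I_mul_ofReal_sub_one, norm_mul, Real.norm_ofNat,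
      Real.norm_eq_abs]
    rw [abs_div, abs_two] at hsin
    linarith
  have hle := (mul_le_mul_of_nonneg_left hchord (norm_nonneg _)).trans hgeom
  rw [← mul_assoc, mul_div_assoc', div_mul_eq_mul_div, div_le_iff₀ Real.pi_pos] at hle
  linarith

lemma fejerKernel_le {k : ℕ} {θ : ℝ} (hθ : |θ| ≤ π) :
    fejerKernel k θ ≤ 2 * (1 + (k / π * θ) ^ 2)⁻¹ := by
  have hdecay : fejerKernel k θ * (k / π * θ) ^ 2 ≤ 1 := by
    have hsq := pow_le_pow_left₀ (by positivity) (norm_geom_sum_exp_mul_abs_le k hθ) 2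
    rw [mul_pow, sq_abs] at hsq
    rcases eq_or_ne (k : ℝ) 0 with hk | hk
    · simp [hk]
    rw [fejerKernel, norm_mul, norm_inv, Complex.norm_natCast]
    field_simp
    exact hsq
  rw [← div_eq_mul_inv, le_div_iff₀ (by positivity)]
  linarith [fejerKernel_le_one k θ]

lemma integrable_inv_one_add_mul_sq {c : ℝ} (hc : c ≠ 0) :
    Integrable fun l : ℝ ↦ (1 + (c * l) ^ 2)⁻¹ :=
  integrable_inv_one_add_sq.comp_mul_left' hc

lemma integral_inv_one_add_mul_sq {c : ℝ} (hc : 0 < c) :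
    ∫ l : ℝ, (1 + (c * l) ^ 2)⁻¹ = π / c := by
  rw [Measure.integral_comp_mul_left (fun x ↦ (1 + x ^ 2)⁻¹), integral_univ_inv_one_add_sq,
    abs_of_pos (inv_pos.2 hc), smul_eq_mul, inv_mul_eq_div]

lemma inv_one_add_mul_sq_le {b c l : ℝ} (hb : 0 < b) (hc : 0 < c) (hl : b ≤ |l|) :
    (1 + (c * l) ^ 2)⁻¹ ≤ ((c * b) ^ 2)⁻¹ := by
  gcongr
  have : (c * b) ^ 2 ≤ (c * l) ^ 2 := by
    rw [mul_pow, mul_pow, ← sq_abs l]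
    gcongr
  linarith

lemma fejerKernel_mul_le {b h : ℝ} (hb : 0 < b) (hh : 0 < h) {k : ℕ} (hk : 0 < k) (l : ℝ) :
    fejerKernel k (l * h) ≤
      (Ioo (-b) b).indicator (fun l ↦ 2 * (1 + (k * h / π * l) ^ 2)⁻¹) l +
        2 * ((k * h / π * b) ^ 2)⁻¹ + {l : ℝ | π / h < |l|}.indicator 1 l := by
  have hpeak : 0 ≤ (Ioo (-b) b).indicator (fun l ↦ 2 * (1 + (k * h / π * l) ^ 2)⁻¹) l :=
    indicator_nonneg (fun l _ ↦ by positivity) l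
  have hmiddle : 0 ≤ 2 * ((k * h / π * b) ^ 2)⁻¹ := by positivity
  by_cases htail : π / h < |l|
  · rw [indicator_of_mem (s := {l : ℝ | π / h < |l|}) htail, Pi.one_apply]
    linarith [fejerKernel_le_one k (l * h)]
  have hkernel : fejerKernel k (l * h) ≤ 2 * (1 + (k * h / π * l) ^ 2)⁻¹ := by
    have hlh : |l * h| ≤ π := by
      rwa [abs_mul, abs_of_pos hh, ← le_div_iff₀ hh, ← not_lt]
    convert fejerKernel_le hlh using 5
    ring
  rw [indicator_of_notMem (s := {l : ℝ | π / h < |l|}) htail, add_zero]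
  by_cases hl : l ∈ Ioo (-b) b
  · rw [indicator_of_mem hl]
    linarith
  · have hbl : b ≤ |l| := not_lt.1 fun hlt ↦ hl (abs_lt.1 hlt)
    linarith [inv_one_add_mul_sq_le hb (c := k * h / π) (by positivity) hbl]

lemma integrable_fejerKernel_mul (ρ : Measure ℝ) [IsFiniteMeasure ρ] (k : ℕ) (h : ℝ) :
    Integrable (fun l ↦ fejerKernel k (l * h)) ρ := by
  simp_rw [← trigEnergy_average]
  exact integrable_trigEnergy ρ _ _

lemma integral_fejerKernel_mul_le {ρ : Measure ℝ} [IsFiniteMeasure ρ] {b M : ℝ} (hb : 0 < b)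
    (hM : 0 ≤ M) (hρ : ρ.restrict (Ioo (-b) b) ≤ (ENNReal.ofReal M • volume).restrict (Ioo (-b) b))
    {k : ℕ} (hk : 0 < k) {h : ℝ} (hh : 0 < h) :
    ∫ l, fejerKernel k (l * h) ∂ρ ≤ 2 * π ^ 2 * M / (k * h) +
      2 * ((k * h / π * b) ^ 2)⁻¹ * ρ.real univ + ρ.real {l | π / h < |l|} := by
  have hc : 0 < k * h / π := by positivity
  have htail : MeasurableSet {l : ℝ | π / h < |l|} :=
    measurableSet_lt measurable_const (by fun_prop)
  obtain ⟨hpeak, hpeak_le⟩ := setIntegral_le_mul_integral hM hρ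
    ((integrable_inv_one_add_mul_sq hc.ne').const_mul 2) fun l ↦ by positivity
  have hpeak' := (integrable_indicator_iff measurableSet_Ioo).2 hpeak
  have htail' : Integrable ({l : ℝ | π / h < |l|}.indicator 1) ρ :=
    (integrable_const (1 : ℝ)).indicator htail
  have hsum : Integrable (fun l ↦ (Ioo (-b) b).indicator
      (fun l ↦ 2 * (1 + (k * h / π * l) ^ 2)⁻¹) l + 2 * ((k * h / π * b) ^ 2)⁻¹) ρ :=
    hpeak'.add (integrable_const _)
  calc ∫ l, fejerKernel k (l * h) ∂ρ
      ≤ ∫ l, ((Ioo (-b) b).indicator (fun l ↦ 2 * (1 + (k * h / π * l) ^ 2)⁻¹) l +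
          2 * ((k * h / π * b) ^ 2)⁻¹ + {l : ℝ | π / h < |l|}.indicator 1 l) ∂ρ :=
        integral_mono (integrable_fejerKernel_mul ρ k h) (hsum.add htail')
          (fejerKernel_mul_le hb hh hk)
    _ = ∫ l in Ioo (-b) b, 2 * (1 + (k * h / π * l) ^ 2)⁻¹ ∂ρ +
          2 * ((k * h / π * b) ^ 2)⁻¹ * ρ.real univ + ρ.real {l | π / h < |l|} := by
        rw [integral_add hsum htail', integral_add hpeak' (integrable_const _),
          integral_indicator measurableSet_Ioo, integral_indicator_one htail, integral_const,
          smul_eq_mul, mul_comm (ρ.real univ)]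
    _ ≤ _ := by
        gcongr
        refine hpeak_le.trans_eq ?_
        rw [integral_const_mul, integral_inv_one_add_mul_sq hc]
        field_simp

end FejerKernel

section ExponentialTilting

/-- The truncated exponential weight `x ↦ 1_{x > 0} exp (-x / K)`, whose product over a family of
values dominates a multiple of the event that they are all positive with a small mean. -/
noncomputable def expTilt (K : ℝ) : ℝ → ℝ≥0∞ :=
  (Ioi 0).indicator fun x ↦ ENNReal.ofReal (Real.exp (-(x / K)))

lemma measurable_expTilt (K : ℝ) : Measurable (expTilt K) :=
  Measurable.indicator (by fun_prop) measurableSet_Ioi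

lemma expTilt_of_pos {K x : ℝ} (hx : 0 < x) :
    expTilt K x = ENNReal.ofReal (Real.exp (-(x / K))) :=
  indicator_of_mem (mem_Ioi.2 hx) _

lemma lintegral_expTilt {K : ℝ} (hK : 0 < K) : ∫⁻ x, expTilt K x = ENNReal.ofReal K := by
  have hneg : -K⁻¹ < 0 := neg_lt_zero.2 (inv_pos.2 hK)
  have hexp : ∀ x : ℝ, Real.exp (-(x / K)) = Real.exp (-K⁻¹ * x) := fun x ↦ by
    rw [neg_mul, div_eq_inv_mul]
  simp_rw [expTilt, hexp]
  rw [lintegral_indicator measurableSet_Ioi, ← ofReal_integral_eq_lintegral_ofReal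
    (integrableOn_exp_mul_Ioi hneg 0) (.of_forall fun x ↦ (Real.exp_pos _).le),
    integral_exp_mul_Ioi hneg]
  simp

/-- The level `K` for which integrating `expTilt K` against a Gaussian density of variance `c` costs
at most a factor `exp (-2)`. -/
noncomputable def smallMeanLevel (c : ℝ) : ℝ := Real.exp (-2) * √(2 * π * c)

lemma smallMeanLevel_pos {c : ℝ} (hc : 0 < c) : 0 < smallMeanLevel c := by
  unfold smallMeanLevel
  positivity

lemma ofReal_inv_sqrt_mul_lintegral_expTilt {c : ℝ} (hc : 0 < c) :
    ENNReal.ofReal (√(2 * π * c))⁻¹ * ∫⁻ x, expTilt (smallMeanLevel c) x =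
      ENNReal.ofReal (Real.exp (-2)) := by
  rw [lintegral_expTilt (smallMeanLevel_pos hc), ← ENNReal.ofReal_mul (by positivity),
    smallMeanLevel]
  congr 1
  field_simp

variable {ι κ : Type*} [Fintype ι] [Fintype κ]

lemma exp_neg_card_le_sum_prod_exp [Nonempty ι] [Nonempty κ] {K : ℝ} (hK : 0 < K) {x : ι × κ → ℝ}
    (hx : ∑ p, (Fintype.card (ι × κ) : ℝ)⁻¹ * x p ≤ K) :
    Real.exp (-Fintype.card ι) ≤
      ∑ s, (Fintype.card κ : ℝ)⁻¹ * ∏ j, Real.exp (-(x (j, s) / K)) := by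
  have hι : (0 : ℝ) < Fintype.card ι := Nat.cast_pos.2 Fintype.card_pos
  have hκ : (0 : ℝ) < Fintype.card κ := Nat.cast_pos.2 Fintype.card_pos
  have hmean : -(Fintype.card ι : ℝ) ≤ ∑ s, (Fintype.card κ : ℝ)⁻¹ * ∑ j, -(x (j, s) / K) := by
    rw [← Finset.mul_sum, Fintype.card_prod, Fintype.sum_prod_type_right, inv_mul_le_iff₀
      (by positivity)] at hx
    simp_rw [Finset.sum_neg_distrib, ← Finset.sum_div, ← Finset.mul_sum, Finset.sum_neg_distrib,
      ← Finset.sum_div]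
    rw [mul_neg, neg_le_neg_iff, inv_mul_le_iff₀ hκ, div_le_iff₀ hK]
    push_cast at hx
    linarith
  have hjensen := convexOn_exp.map_sum_le (t := Finset.univ)
    (w := fun _ : κ ↦ (Fintype.card κ : ℝ)⁻¹) (p := fun s ↦ ∑ j, -(x (j, s) / K))
    (fun _ _ ↦ by positivity) (by simp [hκ.ne']) (fun _ _ ↦ mem_univ _)
  simp only [smul_eq_mul] at hjensen
  simp_rw [← Real.exp_sum]
  exact (Real.exp_le_exp.2 hmean).trans hjensen

lemma ofReal_exp_neg_card_le_sum_prod_expTilt [Nonempty ι] [Nonempty κ] {K : ℝ} (hK : 0 < K)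
    {x : ι × κ → ℝ} (hpos : ∀ p, 0 < x p) (hx : ∑ p, (Fintype.card (ι × κ) : ℝ)⁻¹ * x p ≤ K) :
    ENNReal.ofReal (Real.exp (-Fintype.card ι)) ≤
      ∑ s, ENNReal.ofReal (Fintype.card κ : ℝ)⁻¹ * ∏ j, expTilt K (x (j, s)) := by
  refine (ENNReal.ofReal_le_ofReal (exp_neg_card_le_sum_prod_exp hK hx)).trans_eq ?_
  rw [ENNReal.ofReal_sum_of_nonneg fun s _ ↦ by positivity]
  refine Finset.sum_congr rfl fun s _ ↦ ?_
  rw [ENNReal.ofReal_mul (by positivity), ENNReal.ofReal_prod_of_nonneg fun j _ ↦ by positivity]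
  simp_rw [expTilt_of_pos (hpos _)]

variable {Ω : Type*} [MeasurableSpace Ω] {P : Measure Ω} {X : ι × κ → Ω → ℝ}

lemma measure_forall_pos_and_average_le [Nonempty ι] [Nonempty κ] (hX : ∀ p, AEMeasurable (X p) P)
    {K : ℝ} (hK : 0 < K) (htilt : ∀ s, ∫⁻ ω, ∏ j, expTilt K (X (j, s) ω) ∂P ≤
      ENNReal.ofReal (Real.exp (-2)) ^ Fintype.card ι) :
    P {ω | (∀ p, 0 < X p ω) ∧ ∑ p, (Fintype.card (ι × κ) : ℝ)⁻¹ * X p ω ≤ K} ≤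
      ENNReal.ofReal (Real.exp (-Fintype.card ι)) := by
  set w := ENNReal.ofReal (Fintype.card κ : ℝ)⁻¹ with hw
  set E := ENNReal.ofReal (Real.exp (-Fintype.card ι)) with hE
  have hE0 : E ≠ 0 := (ENNReal.ofReal_pos.2 (Real.exp_pos _)).ne'
  have hEE : E * E = ENNReal.ofReal (Real.exp (-2)) ^ Fintype.card ι := by
    rw [hE, ← ENNReal.ofReal_pow (Real.exp_pos _).le, ← ENNReal.ofReal_mul (Real.exp_pos _).le,
      ← Real.exp_nat_mul, ← Real.exp_add]
    ring_nf
  have hw1 : Fintype.card κ * w = 1 := by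
    have hκ : (0 : ℝ) < Fintype.card κ := Nat.cast_pos.2 Fintype.card_pos
    rw [hw, ← ENNReal.ofReal_natCast, ← ENNReal.ofReal_mul hκ.le, mul_inv_cancel₀ hκ.ne',
      ENNReal.ofReal_one]
  have hprod : ∀ s, AEMeasurable (fun ω ↦ ∏ j, expTilt K (X (j, s) ω)) P := fun s ↦
    Finset.aemeasurable_fun_prod _ fun j _ ↦ (measurable_expTilt K).comp_aemeasurable (hX _)
  rw [← ENNReal.mul_le_mul_iff_right hE0 ENNReal.ofReal_ne_top]
  calc E * P {ω | (∀ p, 0 < X p ω) ∧ ∑ p, (Fintype.card (ι × κ) : ℝ)⁻¹ * X p ω ≤ K}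
      ≤ E * P {ω | E ≤ ∑ s, w * ∏ j, expTilt K (X (j, s) ω)} := by
        gcongr with ω
        exact fun hω ↦ ofReal_exp_neg_card_le_sum_prod_expTilt (x := (X · ω)) hK hω.1 hω.2
    _ ≤ ∫⁻ ω, ∑ s, w * ∏ j, expTilt K (X (j, s) ω) ∂P :=
        mul_meas_ge_le_lintegral₀
          (Finset.aemeasurable_fun_sum _ fun s _ ↦ (hprod s).const_mul w) E
    _ = ∑ s, w * ∫⁻ ω, ∏ j, expTilt K (X (j, s) ω) ∂P := by
        rw [lintegral_finsetSum' _ fun s _ ↦ (hprod s).const_mul w]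
        simp_rw [lintegral_const_mul' w _ ENNReal.ofReal_ne_top]
    _ ≤ ∑ _ : κ, w * (E * E) := by
        gcongr with s
        exact (htilt s).trans_eq hEE.symm
    _ = E * E := by
        rw [Finset.sum_const, Finset.card_univ, nsmul_eq_mul, ← mul_assoc, hw1, one_mul]

lemma measureReal_forall_pos_le [Nonempty ι] [Nonempty κ] (hX : IsGaussianProcess X P)
    (hmean : ∀ p, P[X p] = 0) {c : ℝ} (hc : 0 < c)
    (hslice : ∀ s (a : ι → ℝ), c * ∑ j, a j ^ 2 ≤ Var[fun ω ↦ ∑ j, a j * X (j, s) ω; P])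
    {v : ℝ} (haverage : Var[fun ω ↦ ∑ p, (Fintype.card (ι × κ) : ℝ)⁻¹ * X p ω; P] ≤ v) :
    P.real {ω | ∀ p, 0 < X p ω} ≤
      Real.exp (-smallMeanLevel c ^ 2 / (2 * v)) + Real.exp (-Fintype.card ι) := by
  have := hX.isProbabilityMeasure
  lift c to ℝ≥0 using hc.le
  lift v to ℝ≥0 using (variance_nonneg _ _).trans haverage
  set K := smallMeanLevel c
  have hKpos : 0 < K := smallMeanLevel_pos hc
  set A : Ω → ℝ := fun ω ↦ ∑ p, (Fintype.card (ι × κ) : ℝ)⁻¹ * X p ω with hA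
  have hlaw : HasGaussianLaw A P :=
    (hX.smul fun _ ↦ (Fintype.card (ι × κ) : ℝ)⁻¹).hasGaussianLaw_fun_sum (I := Finset.univ)
  have hA0 : P[A] = 0 := by
    rw [hA, integral_finsetSum _ fun p _ ↦ (hX.hasGaussianLaw_eval p).integrable.const_mul _]
    simp_rw [integral_const_mul, hmean, mul_zero, Finset.sum_const_zero]
  have hlarge : P.real {ω | K ≤ A ω} ≤ Real.exp (-K ^ 2 / (2 * v)) :=
    (hasSubgaussianMGF_of_hasGaussianLaw hlaw hA0 haverage).measure_ge_le hKpos.le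
  have hsmall : P.real {ω | (∀ p, 0 < X p ω) ∧ A ω ≤ K} ≤ Real.exp (-Fintype.card ι) := by
    refine ENNReal.toReal_le_of_le_ofReal (Real.exp_pos _).le
      (measure_forall_pos_and_average_le hX.aemeasurable hKpos fun s ↦ ?_)
    rw [← ofReal_inv_sqrt_mul_lintegral_expTilt hc]
    exact lintegral_prod_le_of_variance_ge (Y := fun j ↦ X (j, s))
      (hasGaussianLaw_of_isGaussianProcess hX (·, s)) (NNReal.coe_pos.1 hc).ne' (hslice s)
      (measurable_expTilt K)
  calc P.real {ω | ∀ p, 0 < X p ω}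
      ≤ P.real ({ω | K ≤ A ω} ∪ {ω | (∀ p, 0 < X p ω) ∧ A ω ≤ K}) :=
        measureReal_mono fun ω hω ↦ (le_total K (A ω)).imp id fun h ↦ ⟨hω, h⟩
    _ ≤ _ := (measureReal_union_le _ _).trans (add_le_add hlarge hsmall)

end ExponentialTilting

section Sampling

variable {Ω : Type*} [MeasurableSpace Ω] {P : Measure Ω} {ρ : Measure ℝ} [IsFiniteMeasure ρ]

lemma measureReal_forall_lt_pos_le {X : ℕ → Ω → ℝ} (hX : IsGaussianProcess X P)
    (hmean : ∀ j, P[X j] = 0) {d : ℝ} (hd : 0 < d) {n q : ℕ} (hn : 0 < n) (hq : 0 < q)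
    (hcov : HasSpectralCovariance X (fun j ↦ j * (d / q)) P ρ) {m : ℝ} (hm : 0 < m)
    (hlow : (ENNReal.ofReal m • volume).restrict (Ioo (-(π / d)) (π / d)) ≤
      ρ.restrict (Ioo (-(π / d)) (π / d)))
    {v : ℝ} (hv : ∫ l, fejerKernel (n * q) (l * (d / q)) ∂ρ ≤ v) :
    P.real {ω | ∀ j < n * q, 0 < X j ω} ≤
      Real.exp (-smallMeanLevel (2 * (π / d) * m) ^ 2 / (2 * v)) + Real.exp (-n) := by
  have := hX.isProbabilityMeasure
  have : NeZero n := ⟨hn.ne'⟩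
  have : NeZero q := ⟨hq.ne'⟩
  have hq' : (q : ℝ) ≠ 0 := Nat.cast_ne_zero.2 hq.ne'
  let u : Fin n × Fin q → ℕ := fun p ↦ finProdFinEquiv p
  have hslice : ∀ s (a : Fin n → ℝ),
      2 * (π / d) * m * ∑ j, a j ^ 2 ≤ Var[fun ω ↦ ∑ j, a j * X (u (j, s)) ω; P] := fun s ↦ by
    have htimes : (fun j : Fin n ↦ (u (j, s) : ℝ) * (d / q)) =
        fun j : Fin n ↦ s * (d / q) + j * d := by
      ext j
      simp only [u, finProdFinEquiv_apply_val]
      push_cast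
      field_simp
    have hcov' := hcov.comp fun j : Fin n ↦ u (j, s)
    rw [htimes] at hcov'
    exact hcov'.le_variance_sum_progression (fun j ↦ hmean _) hd hm.le hlow
  have haverage : Var[fun ω ↦ ∑ p, (Fintype.card (Fin n × Fin q) : ℝ)⁻¹ * X (u p) ω; P] ≤ v := by
    rw [(hcov.comp u).variance_sum_eq_of_centred fun p ↦ hmean _]
    refine (integral_congr_ae (.of_forall fun l ↦ ?_)).trans_le hv
    rw [← trigEnergy_average, ← trigEnergy_comp_equiv finProdFinEquiv]
    simp [u]
  have hbound := measureReal_forall_pos_le (hX.comp_right u) (fun p ↦ hmean _)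
    (by positivity) hslice haverage
  rw [Fintype.card_fin] at hbound
  refine (measureReal_mono ?_).trans hbound
  exact fun ω hω p ↦ hω _ (finProdFinEquiv p).2

variable {T : Type*} {τ : T → ℝ} {d m M : ℝ}

/-- Intervals of length `d` can be subdivided into equal steps between points of the time set
`τ`, such that all but an arbitrarily small part of the spectral measure lies below the Nyquist
frequency `π / step` of the resulting grid. -/
def HasNyquistSampling (τ : T → ℝ) (ρ : Measure ℝ) (d : ℝ) : Prop :=
  ∀ ε > 0, ∃ q : ℕ, 0 < q ∧ (∀ j : ℕ, ∃ t, τ t = j * (d / q)) ∧ ρ.real {l | π / (d / q) < |l|} ≤ ε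

lemma HasNyquistSampling.eventually_exists_integral_fejerKernel_le (hτ : HasNyquistSampling τ ρ d)
    (hd : 0 < d) (hM : 0 ≤ M) (hup : ρ.restrict (Ioo (-(π / d)) (π / d)) ≤
      (ENNReal.ofReal M • volume).restrict (Ioo (-(π / d)) (π / d))) :
    ∀ᶠ n : ℕ in atTop, ∃ q : ℕ, 0 < q ∧ (∃ t : ℕ → T, ∀ j, τ (t j) = j * (d / q)) ∧
      ∫ l, fejerKernel (n * q) (l * (d / q)) ∂ρ ≤ (2 * π ^ 2 * M + 2) / (n * d) := by
  filter_upwards [eventually_gt_atTop 0, eventually_ge_atTop ⌈2 * d * ρ.real univ⌉₊] with n hn hnρ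
  have hn' : (0 : ℝ) < n := Nat.cast_pos.2 hn
  obtain ⟨q, hq, hgrid, htail⟩ := hτ (1 / (n * d)) (by positivity)
  have hq' : (0 : ℝ) < q := Nat.cast_pos.2 hq
  choose t ht using hgrid
  refine ⟨q, hq, ⟨t, ht⟩, ?_⟩
  have hlength : ((n * q : ℕ) : ℝ) * (d / q) = n * d := by
    push_cast
    field_simp
  have hkernel := integral_fejerKernel_mul_le (div_pos Real.pi_pos hd) hM hup (Nat.mul_pos hn hq)
    (div_pos hd hq')
  have hmiddle : 2 * ((n * d / π * (π / d)) ^ 2)⁻¹ * ρ.real univ ≤ 1 / (n * d) := by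
    have hn2 : n * d / π * (π / d) = n := by field_simp
    rw [hn2, le_div_iff₀ (by positivity)]
    calc 2 * ((n : ℝ) ^ 2)⁻¹ * ρ.real univ * (n * d) = 2 * d * ρ.real univ / n := by field_simp
      _ ≤ 1 := div_le_one_of_le₀ (Nat.ceil_le.1 hnρ) hn'.le
  rw [hlength] at hkernel
  calc ∫ l, fejerKernel (n * q) (l * (d / q)) ∂ρ
      ≤ 2 * π ^ 2 * M / (n * d) + 1 / (n * d) + 1 / (n * d) := by linarith
    _ = (2 * π ^ 2 * M + 2) / (n * d) := by ring

variable {X : T → Ω → ℝ} {μ : ℝ}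

lemma HasSpectralCovariance.mean_eq_zero [IsProbabilityMeasure P]
    (hcov : HasSpectralCovariance X τ P ρ) (hmean : ∀ t, P[X t] = μ)
    (hτ : HasNyquistSampling τ ρ d) (hd : 0 < d) (hM : 0 ≤ M)
    (hup : ρ.restrict (Ioo (-(π / d)) (π / d)) ≤
      (ENNReal.ofReal M • volume).restrict (Ioo (-(π / d)) (π / d))) : μ = 0 := by
  have hle : ∀ᶠ n : ℕ in atTop, μ ^ 2 ≤ (2 * π ^ 2 * M + 2) / (n * d) := by
    filter_upwards [hτ.eventually_exists_integral_fejerKernel_le hd hM hup, eventually_gt_atTop 0]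
      with n ⟨q, hq, ⟨t, ht⟩, hkernel⟩ hn
    have hnq : ((n * q : ℕ) : ℝ) ≠ 0 := Nat.cast_ne_zero.2 (Nat.mul_pos hn hq).ne'
    have hgrid := hcov.comp fun j : Fin (n * q) ↦ t j
    simp only [ht] at hgrid
    refine (hgrid.sq_mean_le (fun j ↦ hmean _) (a := fun _ ↦ ((n * q : ℕ) : ℝ)⁻¹) ?_).trans ?_
    · simp [-Nat.cast_mul, hnq]
    · simpa only [trigEnergy_average] using hkernel
  have hlim : Tendsto (fun n : ℕ ↦ (2 * π ^ 2 * M + 2) / (n * d)) atTop (nhds 0) :=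
    (tendsto_natCast_atTop_atTop.atTop_mul_const hd).const_div_atTop _
  exact pow_eq_zero_iff two_ne_zero |>.1 ((ge_of_tendsto hlim hle).antisymm (sq_nonneg μ))

/-- The exponential rate, per time interval of length `d`, for a spectral density between `m` and
`M` on `(-π / d, π / d)`. -/
noncomputable def blockRate (d m M : ℝ) : ℝ :=
  min (smallMeanLevel (2 * (π / d) * m) ^ 2 * d / (2 * (2 * π ^ 2 * M + 2))) 1

lemma blockRate_pos (hd : 0 < d) (hm : 0 < m) (hM : 0 ≤ M) : 0 < blockRate d m M := by
  have := smallMeanLevel_pos (c := 2 * (π / d) * m) (by positivity)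
  exact lt_min (by positivity) one_pos

lemma exp_add_exp_neg_le_blockRate (hd : 0 < d) (hM : 0 ≤ M) (n : ℕ) :
    Real.exp (-smallMeanLevel (2 * (π / d) * m) ^ 2 / (2 * ((2 * π ^ 2 * M + 2) / (n * d)))) +
      Real.exp (-n) ≤ 2 * Real.exp (-blockRate d m M * n) := by
  set K := smallMeanLevel (2 * (π / d) * m)
  have hlarge : -K ^ 2 / (2 * ((2 * π ^ 2 * M + 2) / (n * d))) ≤ -blockRate d m M * n := by
    calc -K ^ 2 / (2 * ((2 * π ^ 2 * M + 2) / (n * d)))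
        = -(K ^ 2 * d / (2 * (2 * π ^ 2 * M + 2))) * n := by
          have : 2 * π ^ 2 * M + 2 ≠ 0 := by positivity
          field_simp
      _ ≤ -blockRate d m M * n := by
          gcongr
          exact min_le_left _ _
  have hsmall : -(n : ℝ) ≤ -blockRate d m M * n := by
    rw [neg_mul, neg_le_neg_iff]
    exact mul_le_of_le_one_left n.cast_nonneg (min_le_right _ _)
  linarith [Real.exp_le_exp.2 hlarge, Real.exp_le_exp.2 hsmall]

lemma HasSpectralCovariance.eventually_measureReal_forall_pos_le
    (hcov : HasSpectralCovariance X τ P ρ) (hX : IsGaussianProcess X P) (hmean : ∀ t, P[X t] = μ)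
    (hτ : HasNyquistSampling τ ρ d) (hd : 0 < d) (hm : 0 < m) (hM : 0 ≤ M)
    (hlow : (ENNReal.ofReal m • volume).restrict (Ioo (-(π / d)) (π / d)) ≤
      ρ.restrict (Ioo (-(π / d)) (π / d)))
    (hup : ρ.restrict (Ioo (-(π / d)) (π / d)) ≤
      (ENNReal.ofReal M • volume).restrict (Ioo (-(π / d)) (π / d))) :
    ∀ᶠ n : ℕ in atTop, P.real {ω | ∀ t, τ t ∈ Ico 0 (n * d) → 0 < X t ω} ≤
      2 * Real.exp (-blockRate d m M * n) := by
  have := hX.isProbabilityMeasure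
  obtain rfl : μ = 0 := hcov.mean_eq_zero hmean hτ hd hM hup
  filter_upwards [hτ.eventually_exists_integral_fejerKernel_le hd hM hup, eventually_gt_atTop 0]
    with n ⟨q, hq, ⟨t, ht⟩, hkernel⟩ hn
  have hq' : (0 : ℝ) < q := Nat.cast_pos.2 hq
  have hgrid := hcov.comp t
  simp only [ht] at hgrid
  have hmem : ∀ j < n * q, τ (t j) ∈ Ico 0 (n * d) := fun j hj ↦ by
    have hj' : (j : ℝ) < n * q := by exact_mod_cast hj
    rw [ht, mul_div_assoc', mem_Ico, div_lt_iff₀ hq', mul_right_comm]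
    exact ⟨by positivity, by gcongr⟩
  calc P.real {ω | ∀ t, τ t ∈ Ico 0 (n * d) → 0 < X t ω}
      ≤ P.real {ω | ∀ j < n * q, 0 < X (t j) ω} :=
        measureReal_mono fun ω hω j hj ↦ hω _ (hmem j hj)
    _ ≤ _ := measureReal_forall_lt_pos_le (hX.comp_right t) (fun j ↦ hmean _) hd hn hq hgrid hm
        hlow hkernel
    _ ≤ 2 * Real.exp (-blockRate d m M * n) := exp_add_exp_neg_le_blockRate hd hM n

end Sampling

lemma eventually_le_exp_of_antitone {H : ℝ → ℝ} (hH : Antitone H) {d κ c C : ℝ} (hd : 0 < d)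
    (hκ : 0 ≤ κ) (hC : 0 ≤ C) (hc : c < κ / d)
    (h : ∀ᶠ n : ℕ in atTop, H (n * d) ≤ C * Real.exp (-κ * n)) :
    ∀ᶠ N : ℝ in atTop, H N ≤ Real.exp (-c * N) := by
  have hfloor : Tendsto (fun N : ℝ ↦ ⌊N / d⌋₊) atTop atTop :=
    tendsto_nat_floor_atTop.comp (tendsto_id.atTop_div_const hd)
  have hgrowth : Tendsto (fun N ↦ Real.exp ((κ / d - c) * N)) atTop atTop :=
    Real.tendsto_exp_atTop.comp (tendsto_id.const_mul_atTop (sub_pos.2 hc))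
  filter_upwards [hfloor.eventually h, hgrowth.eventually_ge_atTop (C * Real.exp κ),
    eventually_ge_atTop 0] with N hblock hN hN0
  have hle : ⌊N / d⌋₊ * d ≤ N := (le_div_iff₀ hd).1 (Nat.floor_le (by positivity))
  have hκle : -κ * ⌊N / d⌋₊ ≤ κ - κ / d * N := by
    have := mul_le_mul_of_nonneg_left (Nat.lt_floor_add_one (N / d)).le hκ
    rw [mul_div_assoc', ← div_mul_eq_mul_div] at this
    linarith
  calc H N ≤ H (⌊N / d⌋₊ * d) := hH hle
    _ ≤ C * Real.exp (κ - κ / d * N) := hblock.trans (by gcongr)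
    _ = C * Real.exp κ * Real.exp (-(κ / d) * N) := by
        rw [mul_assoc, ← Real.exp_add]
        ring_nf
    _ ≤ Real.exp ((κ / d - c) * N) * Real.exp (-(κ / d) * N) := by gcongr
    _ = Real.exp (-c * N) := by
        rw [← Real.exp_add]
        ring_nf

section Persistence

variable {Ω : Type*} [MeasurableSpace Ω] {P : Measure Ω} {T : Type} {f : T → Ω → ℝ}
  {ρ : Measure ℝ}

lemma gapProbability_antitone [IsFiniteMeasure P] [TimeSet T] : Antitone (gapProbability f P) :=
  fun _ _ hN ↦ measureReal_mono fun _ hω t ht ↦ hω t (Ico_subset_Ico_right hN ht)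

/-- Weak stationarity: the mean is constant and the second moments depend only on the time
difference. -/
structure IsWeaklyStationary [AddGroup T] (f : T → Ω → ℝ) (P : Measure Ω) : Prop where
  integral_eq : ∀ t, P[f t] = P[f 0]
  integral_mul : ∀ s t, ∫ ω, f s ω * f t ω ∂P = covarianceFn f P (s - t)

lemma IsGaussianStationary.isWeaklyStationary [AddCommGroup T] [TopologicalSpace T]
    (hf : IsGaussianStationary f P) : IsWeaklyStationary f P where
  integral_eq t := by
    have := (hf.stationary t 1 fun _ ↦ 0).comp (u := fun x : Fin 1 → ℝ ↦ x 0) (by fun_prop)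
    simpa [Function.comp_def] using this.integral_eq
  integral_mul s t := by
    have := (hf.stationary t 2 ![0, s - t]).comp (u := fun x : Fin 2 → ℝ ↦ x 0 * x 1) (by fun_prop)
    simpa [Function.comp_def, covarianceFn, mul_comm] using this.integral_eq

lemma IsSpectralMeasure.covarianceFn_eq [Zero T] [TimeSet T] (hρ : IsSpectralMeasure f P ρ)
    (t : T) : covarianceFn f P t = ∫ l, Real.cos (l * TimeSet.toReal t) ∂ρ := by
  have := hρ.finite
  have hint : Integrable (fun l : ℝ ↦
      Complex.exp (-(Complex.I * (l : ℂ) * (TimeSet.toReal t : ℂ)))) ρ :=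
    .of_bound (by fun_prop : Continuous _).aestronglyMeasurable 1
      (.of_forall fun l ↦ by simp [Complex.norm_exp])
  have hre := congrArg Complex.re (hρ.fourier t)
  rw [Complex.ofReal_re, ← RCLike.re_eq_complex_re, ← integral_re hint] at hre
  rw [hre]
  congr 1 with l
  simp [Complex.exp_re]

lemma IsSpectralMeasure.hasSpectralCovariance [AddGroup T] [TimeSet T]
    (hρ : IsSpectralMeasure f P ρ) (hf : IsGaussianProcess f P) (hstat : IsWeaklyStationary f P)
    (hsub : ∀ s t : T, TimeSet.toReal (s - t) = TimeSet.toReal s - TimeSet.toReal t) :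
    HasSpectralCovariance f TimeSet.toReal P ρ where
  memLp t := (hf.hasGaussianLaw_eval t).memLp_two
  integral_mul s t := by rw [hstat.integral_mul, hρ.covarianceFn_eq, hsub]

lemma IsSpectralMeasure.hasNyquistSampling_int {f : ℤ → Ω → ℝ} (hρ : IsSpectralMeasure f P ρ)
    {d : ℕ} (hd : 0 < d) : HasNyquistSampling (TimeSet.toReal (T := ℤ)) ρ d := by
  intro ε hε
  have hd' : (d : ℝ) ≠ 0 := Nat.cast_ne_zero.2 hd.ne'
  refine ⟨d, hd, fun j ↦ ⟨j, ?_⟩, ?_⟩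
  · rw [div_self hd', mul_one]
    exact Int.cast_natCast j
  · have hnull : ρ {l | π / ((d : ℝ) / d) < |l|} = 0 := by
      refine measure_mono_null (t := (TimeSet.dual ℤ)ᶜ) (fun l hl hmem ↦ ?_) hρ.carried
      rw [mem_ofPred_eq, div_self hd', div_one] at hl
      exact hl.not_ge (abs_le.2 hmem)
    rw [measureReal_def, hnull]
    exact hε.le

lemma tendsto_measureReal_lt_abs (ρ : Measure ℝ) [IsFiniteMeasure ρ] :
    Tendsto (fun r : ℝ ↦ ρ.real {l | r < |l|}) atTop (nhds 0) := by
  have htight := tendsto_measure_norm_gt_of_isTightMeasureSet (isTightMeasureSet_singleton (μ := ρ))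
  simp only [mem_singleton_iff, iSup_iSup_eq_left, Real.norm_eq_abs] at htight
  exact (ENNReal.tendsto_toReal ENNReal.zero_ne_top).comp htight

lemma hasNyquistSampling_real (ρ : Measure ℝ) [IsFiniteMeasure ρ] {d : ℝ} (hd : 0 < d) :
    HasNyquistSampling (TimeSet.toReal (T := ℝ)) ρ d := by
  intro ε hε
  have hcutoff : Tendsto (fun q : ℕ ↦ π / (d / q)) atTop atTop := by
    simp_rw [div_div_eq_mul_div, mul_comm π, mul_div_assoc]
    exact tendsto_natCast_atTop_atTop.atTop_mul_const (div_pos Real.pi_pos hd)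
  have htail := ((tendsto_measureReal_lt_abs ρ).comp hcutoff).eventually (Iic_mem_nhds hε)
  obtain ⟨q, hq, hq0⟩ := (htail.and (eventually_gt_atTop 0)).exists
  exact ⟨q, hq0, fun j ↦ ⟨j * (d / q), rfl⟩, hq⟩

/-- The exponential rate, per unit of time, for a spectral density between `m` and `M` on
`(-π / d, π / d)`; any fraction of `blockRate d m M / d` would do. -/
noncomputable def persistenceRate (d m M : ℝ) : ℝ := blockRate d m M / d / 2

lemma persistenceRate_pos {d m M : ℝ} (hd : 0 < d) (hm : 0 < m) (hM : 0 ≤ M) :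
    0 < persistenceRate d m M :=
  half_pos (div_pos (blockRate_pos hd hm hM) hd)

lemma IsSpectralMeasure.eventually_gapProbability_le [AddGroup T] [TimeSet T]
    (hρ : IsSpectralMeasure f P ρ) (hf : IsGaussianProcess f P) (hstat : IsWeaklyStationary f P)
    (hsub : ∀ s t : T, TimeSet.toReal (s - t) = TimeSet.toReal s - TimeSet.toReal t)
    {d m M a : ℝ} (hτ : HasNyquistSampling (TimeSet.toReal (T := T)) ρ d) (hd : 0 < d)
    (hm : 0 < m) (hM : 0 ≤ M) (hcomp : ComparableNearZero T ρ a m M)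
    (hda : Ioo (-(π / d)) (π / d) ⊆ Ioo (-a) a ∩ TimeSet.dual T) :
    ∀ᶠ N : ℝ in atTop, gapProbability f P N ≤ Real.exp (-persistenceRate d m M * N) := by
  have := hf.isProbabilityMeasure
  have := hρ.finite
  obtain ⟨hlow, hup⟩ := hcomp.restrict_le hda
  have hblock := (hρ.hasSpectralCovariance hf hstat hsub).eventually_measureReal_forall_pos_le hf
    hstat.integral_eq hτ hd hm hM hlow hup
  have hκ := blockRate_pos hd hm hM
  exact eventually_le_exp_of_antitone gapProbability_antitone hd hκ.le zero_le_two
    (half_lt_self (div_pos hκ hd)) hblock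

lemma eventually_gapProbability_int_le {f : ℤ → Ω → ℝ} (hf : IsGaussianProcess f P)
    (hstat : IsWeaklyStationary f P) (hρ : IsSpectralMeasure f P ρ) {a m M : ℝ} (hm : 0 < m)
    (hM : 0 ≤ M) (hcomp : ComparableNearZero ℤ ρ a m M) {d : ℕ} (hd : 0 < d) (hda : π / d ≤ a) :
    ∀ᶠ N : ℝ in atTop, gapProbability f P N ≤ Real.exp (-persistenceRate d m M * N) := by
  have hdπ : π / d ≤ π := div_le_self Real.pi_pos.le (Nat.one_le_cast.2 hd)
  refine hρ.eventually_gapProbability_le hf hstat Int.cast_sub (hρ.hasNyquistSampling_int hd)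
    (Nat.cast_pos.2 hd) hm hM hcomp (subset_inter (Ioo_subset_Ioo (neg_le_neg hda) hda) ?_)
  exact Ioo_subset_Icc_self.trans (Icc_subset_Icc (neg_le_neg hdπ) hdπ)

lemma eventually_gapProbability_real_le {f : ℝ → Ω → ℝ} (hf : IsGaussianProcess f P)
    (hstat : IsWeaklyStationary f P) (hρ : IsSpectralMeasure f P ρ) {a m M : ℝ} (hm : 0 < m)
    (hM : 0 ≤ M) (hcomp : ComparableNearZero ℝ ρ a m M) {d : ℝ} (hd : 0 < d) (hda : π / d ≤ a) :
    ∀ᶠ N : ℝ in atTop, gapProbability f P N ≤ Real.exp (-persistenceRate d m M * N) := by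
  have := hρ.finite
  exact hρ.eventually_gapProbability_le hf hstat (fun _ _ ↦ rfl) (hasNyquistSampling_real ρ hd) hd
    hm hM hcomp (subset_inter (Ioo_subset_Ioo (neg_le_neg hda) hda) (subset_univ _))

end Persistence

end GaussianPersistence

theorem theorem1_general (a m M : ℝ) (ha : 0 < a) (hm : 0 < m) (hM : 0 < M) :
    ∃ C : ℝ, 0 < C ∧
      (∀ (Ω : Type*) [MeasurableSpace Ω] (P : Measure Ω) (f : ℤ → Ω → ℝ) (ρ : Measure ℝ),
        IsGaussianProcess f P →
        GaussianPersistence.IsWeaklyStationary f P →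
        GaussianPersistence.IsSpectralMeasure f P ρ →
        GaussianPersistence.ComparableNearZero ℤ ρ a m M →
        ∀ᶠ N : ℝ in atTop,
          GaussianPersistence.gapProbability f P N ≤ Real.exp (-C * N)) ∧
      (∀ (Ω : Type*) [MeasurableSpace Ω] (P : Measure Ω) (f : ℝ → Ω → ℝ) (ρ : Measure ℝ),
        IsGaussianProcess f P →
        GaussianPersistence.IsWeaklyStationary f P →
        GaussianPersistence.IsSpectralMeasure f P ρ →
        GaussianPersistence.ComparableNearZero ℝ ρ a m M →
        ∀ᶠ N : ℝ in atTop,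
          GaussianPersistence.gapProbability f P N ≤ Real.exp (-C * N)) := by
  obtain ⟨d, hd⟩ := exists_nat_ge (Real.pi / a)
  have hd' : (0 : ℝ) < d := (div_pos Real.pi_pos ha).trans_le hd
  have hda : Real.pi / d ≤ a := (div_le_comm₀ hd' ha).2 hd
  exact ⟨GaussianPersistence.persistenceRate d m M,
    GaussianPersistence.persistenceRate_pos hd' hm hM.le,
    fun _ _ _ _ _ hf hstat hρ hcomp ↦ GaussianPersistence.eventually_gapProbability_int_le hf hstat
      hρ hm hM.le hcomp (Nat.cast_pos.1 hd') hda,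
    fun _ _ _ _ _ hf hstat hρ hcomp ↦ GaussianPersistence.eventually_gapProbability_real_le hf hstat
      hρ hm hM.le hcomp hd' hda⟩

theorem theorem1 (a m M : ℝ) (ha : 0 < a) (hm : 0 < m) (hM : 0 < M) :
    ∃ C : ℝ, 0 < C ∧
      (∀ (Ω : Type*) [MeasurableSpace Ω] (P : Measure Ω) [IsProbabilityMeasure P]
        (f : ℤ → Ω → ℝ) (ρ : Measure ℝ),
        GaussianPersistence.IsGaussianStationary f P →
        GaussianPersistence.IsSpectralMeasure f P ρ →
        GaussianPersistence.MomentCondition ρ →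
        GaussianPersistence.ComparableNearZero ℤ ρ a m M →
        ∀ᶠ N : ℝ in atTop,
          GaussianPersistence.gapProbability f P N ≤ Real.exp (-C * N)) ∧
      (∀ (Ω : Type*) [MeasurableSpace Ω] (P : Measure Ω) [IsProbabilityMeasure P]
        (f : ℝ → Ω → ℝ) (ρ : Measure ℝ),
        GaussianPersistence.IsGaussianStationary f P →
        GaussianPersistence.IsSpectralMeasure f P ρ →
        GaussianPersistence.MomentCondition ρ →
        GaussianPersistence.ComparableNearZero ℝ ρ a m M →
        ∀ᶠ N : ℝ in atTop,
          GaussianPersistence.gapProbability f P N ≤ Real.exp (-C * N)) := by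
  obtain ⟨C, hC, hint, hreal⟩ := theorem1_general a m M ha hm hM
  exact ⟨C, hC, fun _ _ P _ f ρ hf hρ _ ↦ hint _ P f ρ hf.gaussian hf.isWeaklyStationary hρ,
    fun _ _ P _ f ρ hf hρ _ ↦ hreal _ P f ρ hf.gaussian hf.isWeaklyStationary hρ⟩
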